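/- For a finite connected simple graph $G$ with at least one edge, consider the simple random walk on $G$ (from a vertex, move to a uniformly chosen neighbour), with stationary distribution $\pi(j)=\deg(j)/(2|E(G)|)$, and let $m_{ij}$ be the mean first passage time from $i$ to $j$, i.e. the expected value of $\min\{t\ge 0: X_t=j\}$ for the walk started at $X_0=i$ (so $m_{jj}=0$). Kemeny's constant of $G$ is $\kappa(G)=\sum_j m_{ij}\pi(j)$, which does not depend on the vertex $i$. A pair $\{u,v\}$ of distinct nonadjacent vertices of $G$ is a Braess edge of $G$ if $\kappa(G+\{u,v\})>\kappa(G)$, where $G+\{u,v\}$ is $G$ with the edge $\{u,v\}$ added. Let $B(G)$ be the number of Braess edges of $G$. For $a,b\ge 1$ let $\mathcal S_{a,b}$ be the tree consisting of a center vertex and $b$ disjoint paths with $a$ vertices each, one endpoint of each path being joined by an edge to the center. For graphs $G_1,G_2$ with vertices $v_1\in V(G_1)$, $v_2\in V(G_2)$ let $G_1\bigoplus_{v_1,v_2}G_2$ be the graph obtained from disjoint copies of $G_1$ and $G_2$ by identifying $v_1$ with $v_2$. Theorem. For all integers $b_1,b_2\ge 1$, $$B\Big(\mathcal S_{1,b_1}\textstyle\bigoplus_{v_1,v_2}\mathcal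 S_{2,b_2}\Big)=\binom{b_1}{2},$$ where $v_1$ and $v_2$ are the centers of $\mathcal S_{1,b_1}$ and $\mathcal S_{2,b_2}$. -/

import Mathlib

open scoped ENNReal

noncomputable section

namespace SimpleGraph

/-! ### The simple random walk on a finite graph and Kemeny's constant -/

section Walk

variable {V : Type*} [Fintype V]

open scoped Classical in
/-- Transition probability of the simple random walk on `G`: from `i`, jump to a uniformly
chosen neighbour of `i`. -/
def transProb (G : SimpleGraph V) (i j : V) : ℝ≥0∞ :=
  if G.Adj i j then (G.degree i : ℝ≥0∞)⁻¹ else 0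

open scoped Classical in
/-- The stationary distribution of the simple random walk on `G`: `π(j) = deg(j) / (2 |E(G)|)`.
See `sum_statDist` and `sum_statDist_mul_transProb`. -/
def statDist (G : SimpleGraph V) (j : V) : ℝ≥0∞ :=
  (G.degree j : ℝ≥0∞) / (2 * (G.edgeFinset.card : ℝ≥0∞))

open scoped Classical in
/-- The probability that the walk `X₀, X₁, …` started at `i` satisfies `T = t`, where
`T = min {s ≥ 0 : X_s = j}` is the first passage time to `j`: the sum, over all trajectories
`x₀ = i, x₁, …, x_t = j` with `x_s ≠ j` for `s < t`, of the product of the transition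
probabilities along the trajectory. -/
def firstPassageProb (G : SimpleGraph V) (i j : V) (t : ℕ) : ℝ≥0∞ :=
  ∑ x : Fin (t + 1) → V,
    if x 0 = i ∧ x (Fin.last t) = j ∧ ∀ s : Fin t, x s.castSucc ≠ j then
      ∏ s : Fin t, G.transProb (x s.castSucc) (x s.succ)
    else 0

/-- The mean first passage time `m_{ij}` from `i` to `j`, i.e. the expectation
`∑ₜ t · P(T = t) + ∞ · P(T = ∞)` of the first passage time (so `m_{jj} = 0`). -/
def meanFirstPassage (G : SimpleGraph V) (i j : V) : ℝ≥0∞ :=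
  (∑' t : ℕ, (t : ℝ≥0∞) * G.firstPassageProb i j t) +
    ⊤ * (1 - ∑' t : ℕ, G.firstPassageProb i j t)

/-- The quantity `∑_j m_{ij} π(j)`, computed from the starting vertex `i`. For a connected graph
it does not depend on `i`, and its value is Kemeny's constant of the graph. -/
def kemenyFrom (G : SimpleGraph V) (i : V) : ℝ≥0∞ :=
  ∑ j : V, G.meanFirstPassage i j * G.statDist j

/-- Kemeny's constant `κ(G)` of a connected graph: `∑_j m_{ij} π(j)` for any starting vertex `i`
(the sum being independent of `i`). -/
def kemeny [Nonempty V] (G : SimpleGraph V) : ℝ≥0∞ :=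
  G.kemenyFrom (Classical.arbitrary V)

/-- A pair `e = {u, v}` of distinct nonadjacent vertices of `G` is a Braess edge of `G` if adding
the edge `e` to `G` (strictly) increases Kemeny's constant. -/
def IsBraessEdge [Nonempty V] (G : SimpleGraph V) (e : Sym2 V) : Prop :=
  ¬ e.IsDiag ∧ e ∉ G.edgeSet ∧ G.kemeny < (G ⊔ fromEdgeSet {e}).kemeny

/-- The number `B(G)` of Braess edges of `G`. -/
def numBraessEdges [Nonempty V] (G : SimpleGraph V) : ℕ :=
  {e : Sym2 V | G.IsBraessEdge e}.ncard

/-- The numbers `statDist` sum to `1` as soon as the graph has an edge. -/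
theorem sum_statDist (G : SimpleGraph V) (hG : G ≠ ⊥) : ∑ j, G.statDist j = 1 := by
  classical
  unfold statDist
  simp only [div_eq_mul_inv]
  rw [← Finset.sum_mul, ← Nat.cast_sum]
  have h := G.sum_degrees_eq_twice_card_edges
  have h0 : G.edgeFinset.card ≠ 0 := by
    rw [Finset.card_ne_zero]
    simpa using hG
  have h1 : (2 * (G.edgeFinset.card : ℝ≥0∞)) ≠ 0 := by simp [h0]
  have h2 : (2 * (G.edgeFinset.card : ℝ≥0∞)) ≠ ⊤ := ENNReal.mul_ne_top (by simp) (by simp)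
  have h3 := ENNReal.mul_inv_cancel h1 h2
  nth_rewrite 1 [← Nat.cast_two, ← Nat.cast_mul, ← h] at h3
  convert h3

/-- `statDist` is invariant under one step of the walk. -/
theorem sum_statDist_mul_transProb (G : SimpleGraph V) (j : V) :
    ∑ i, G.statDist i * G.transProb i j = G.statDist j := by
  classical
  have key : ∀ i, G.statDist i * G.transProb i j =
      if G.Adj j i then (2 * (G.edgeFinset.card : ℝ≥0∞))⁻¹ else 0 := by
    intro i
    unfold statDist transProb
    by_cases h : G.Adj i j
    · have hd : (G.degree i : ℝ≥0∞) ≠ 0 := by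
        have := (G.degree_pos_iff_exists_adj i).2 ⟨j, h⟩
        exact_mod_cast this.ne'
      rw [if_pos h, if_pos h.symm, div_eq_mul_inv, mul_right_comm]
      have h1 := ENNReal.mul_inv_cancel hd (by simp)
      have h2 : (G.degree i : ℝ≥0∞) * (G.degree i : ℝ≥0∞)⁻¹ *
          (2 * (G.edgeFinset.card : ℝ≥0∞))⁻¹ = (2 * (G.edgeFinset.card : ℝ≥0∞))⁻¹ := by
        rw [h1, one_mul]
      convert h2
    · rw [if_neg h, if_neg (fun h' => h h'.symm), mul_zero]
  simp only [key]
  rw [← Finset.sum_filter, Finset.sum_const, nsmul_eq_mul, statDist, div_eq_mul_inv]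
  congr 2
  rw [← SimpleGraph.card_neighborFinset_eq_degree, neighborFinset_eq_filter]

end Walk

/-! ### One-sums and spiders -/

/-- The `1`-sum of `G₁` and `G₂`, identifying `v₁` with `v₂`: take disjoint copies of `G₁` and
`G₂`, remove `v₁`, and replace every edge `{x, v₁}` of `G₁` by `{x, v₂}`. -/
def oneSum {V₁ V₂ : Type*} (G₁ : SimpleGraph V₁) (G₂ : SimpleGraph V₂) (v₁ : V₁) (v₂ : V₂) :
    SimpleGraph ({x : V₁ // x ≠ v₁} ⊕ V₂) where
  Adj p q := match p, q with
    | Sum.inl x, Sum.inl y => G₁.Adj x y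
    | Sum.inl x, Sum.inr y => G₁.Adj x v₁ ∧ y = v₂
    | Sum.inr x, Sum.inl y => G₁.Adj y v₁ ∧ x = v₂
    | Sum.inr x, Sum.inr y => G₂.Adj x y
  symm := ⟨by
    rintro (x | x) (y | y) h
    · exact SimpleGraph.Adj.symm h
    · exact h
    · exact h
    · exact SimpleGraph.Adj.symm h⟩
  loopless := ⟨by
    rintro (x | x) h
    · exact G₁.irrefl h
    · exact G₂.irrefl h⟩

/-- Vertices of the spider `S_{a,b}`: the center `none`, and the vertices `some (l, d)` with
`l < b` the index of the leg; `some (l, d)` is at distance `d + 1` from the center. -/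
abbrev SpiderVertex (a b : ℕ) : Type := Option (Fin b × Fin a)

/-- The center of the spider `S_{a,b}`, a vertex of degree `b`. -/
def spiderCenter (a b : ℕ) : SpiderVertex a b := none

/-- The spider `S_{a,b}`: `b` legs, each a path with `a` vertices, one endpoint of each joined to
the center. -/
def spider (a b : ℕ) : SimpleGraph (SpiderVertex a b) where
  Adj p q := match p, q with
    | none, none => False
    | none, some y => y.2.val = 0
    | some x, none => x.2.val = 0
    | some x, some y => x.1 = y.1 ∧ (x.2.val + 1 = y.2.val ∨ y.2.val + 1 = x.2.val)
  symm := ⟨by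
    rintro (_ | x) (_ | y) h
    · exact h
    · exact h
    · exact h
    · exact ⟨h.1.symm, h.2.symm⟩⟩
  loopless := ⟨by
    rintro (_ | x) h
    · exact h
    · have := h.2
      omega⟩

end SimpleGraph

end

/-! Write d for the degree, D for the total degree and r for the effective resistance. Then m_ij =
Σ_k d_k (r_ij + r_jk − r_ik)/2, and averaging over j gives κ = (Σ_{j,k} d_j d_k r_jk)/(2D) from
every starting vertex (`IsResistance.kemenyFrom_eq`). Resistance enters only through Σ_l a_il (r_ik
− r_lk) = μ_i − 2δ_ik with μ_i independent of k. No uniqueness of r is needed, because a finite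
solution of the first-step equations is already the passage time.

Adding an edge {u, v} is a rank-one change of the Laplacian, so the new r is explicit
(`IsResistance.edgeUpdate`). Being a Braess edge thus becomes a polynomial inequality in data of the
original graph: ρ = r_uv, S = Σ d_j d_k r_jk, D, T_w = Σ d_k r_kw and Q = Σ d_k (r_ku − r_kv)²
(`IsResistance.isBraessEdge_iff`).

In a tree r is the distance. The vertices are leaves, center, mids and tips, which leaves seven
kinds of nonadjacent pair. For two leaves the right side of the inequality exceeds the left by 8D(D
− 7) + 24b₁ + 240b₂, positive since D = 2b₁ + 4b₂ ≥ 8. For the other six kinds the difference is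
negative. Hence the Braess edges are exactly the pairs of leaves. -/

noncomputable section

namespace SimpleGraph

/-! ### Mean first passage times from first-step equations -/

section FirstPassage

open Filter Topology

variable {V : Type*} [Fintype V]

open scoped Classical in
theorem firstPassageProb_zero (G : SimpleGraph V) (i j : V) :
    G.firstPassageProb i j 0 = if i = j then 1 else 0 := by
  unfold firstPassageProb
  rw [← (Equiv.funUnique (Fin 1) V).symm.sum_comp]
  simp only [Equiv.funUnique_symm_apply, Finset.univ_eq_empty, Finset.prod_empty,
    IsEmpty.forall_iff, and_true, uniqueElim_const]
  by_cases h : i = j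
  · subst h
    simp
  · rw [if_neg h]
    refine Finset.sum_eq_zero fun x _ => if_neg ?_
    rintro ⟨h1, h2⟩
    exact h (h1.symm.trans h2)

open scoped Classical in
-- Condition on the first step: `Fin.consEquiv` splits off the initial vertex of a trajectory. If i
-- = j nothing survives, since a positive passage time forbids j at time 0.
theorem firstPassageProb_succ (G : SimpleGraph V) (i j : V) (t : ℕ) :
    G.firstPassageProb i j (t + 1) =
      if i = j then 0 else ∑ k, G.transProb i k * G.firstPassageProb k j t := by
  have hR : ∑ k, G.transProb i k * G.firstPassageProb k j t =
      ∑ x : Fin (t + 1) → V, G.transProb i (x 0) *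
        (if x (Fin.last t) = j ∧ ∀ s : Fin t, x s.castSucc ≠ j then
          ∏ s : Fin t, G.transProb (x s.castSucc) (x s.succ) else 0) := by
    simp only [firstPassageProb, Finset.mul_sum]
    rw [Finset.sum_comm]
    refine Finset.sum_congr rfl fun x _ => ?_
    rw [Finset.sum_eq_single (x 0)]
    · simp
    · intro k _ hk
      rw [if_neg (fun h => hk h.1.symm), mul_zero]
    · simp
  rw [hR]
  unfold firstPassageProb
  rw [← (Fin.consEquiv (fun _ : Fin (t + 2) => V)).sum_comp, Fintype.sum_prod_type]
  rw [Finset.sum_eq_single i]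
  · by_cases hij : i = j
    · rw [if_pos hij]
      refine Finset.sum_eq_zero fun x _ => if_neg ?_
      rintro ⟨-, -, h⟩
      exact h 0 (by simpa [Fin.consEquiv] using hij)
    · rw [if_neg hij]
      refine Finset.sum_congr rfl fun x _ => ?_
      rw [mul_ite, mul_zero]
      refine if_congr ?_ ?_ rfl
      · rw [Fin.forall_fin_succ]
        simp [Fin.consEquiv, hij, ← Fin.succ_last, ← Fin.succ_castSucc, -Fin.castSucc_succ]
      · rw [Fin.prod_univ_succ]
        simp [Fin.consEquiv, ← Fin.succ_castSucc, -Fin.castSucc_succ]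
  · intro k _ hk
    refine Finset.sum_eq_zero fun x _ => if_neg ?_
    rintro ⟨h, -⟩
    exact hk (by simpa [Fin.consEquiv] using h)
  · simp

open scoped Classical in
theorem sum_transProb (G : SimpleGraph V) (i : V) (hi : 0 < G.degree i) :
    ∑ k, G.transProb i k = 1 := by
  unfold transProb
  rw [← Finset.sum_filter, Finset.sum_const, nsmul_eq_mul, ← neighborFinset_eq_filter,
    card_neighborFinset_eq_degree]
  refine ENNReal.mul_inv_cancel ?_ (ENNReal.natCast_ne_top _)
  exact_mod_cast hi.ne'

open scoped Classical in
/-- The one-step operator of the walk killed at `j`. -/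
def killedStep (G : SimpleGraph V) (j : V) (f : V → ℝ≥0∞) (i : V) : ℝ≥0∞ :=
  if i = j then 0 else ∑ k, G.transProb i k * f k

theorem killedStep_add (G : SimpleGraph V) (j : V) (f g : V → ℝ≥0∞) :
    G.killedStep j (f + g) = G.killedStep j f + G.killedStep j g := by
  funext i
  by_cases h : i = j <;> simp [killedStep, h, mul_add, Finset.sum_add_distrib]

theorem killedStep_smul (G : SimpleGraph V) (j : V) (c : ℝ≥0∞) (f : V → ℝ≥0∞) :
    G.killedStep j (c • f) = c • G.killedStep j f := by
  funext i
  by_cases h : i = j <;> simp [killedStep, h, Finset.mul_sum, mul_left_comm]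

theorem killedStep_mono (G : SimpleGraph V) (j : V) : Monotone (G.killedStep j) := by
  intro f g hfg i
  unfold killedStep
  split_ifs
  · exact le_rfl
  · exact Finset.sum_le_sum fun k _ => by gcongr; exact hfg k

theorem killedStep_sum (G : SimpleGraph V) (j : V) (f : ℕ → V → ℝ≥0∞) (N : ℕ) :
    G.killedStep j (∑ s ∈ Finset.range N, f s) = ∑ s ∈ Finset.range N, G.killedStep j (f s) := by
  induction N with
  | zero =>
    funext i
    simp [killedStep]
  | succ N ih => rw [Finset.sum_range_succ, Finset.sum_range_succ, killedStep_add, ih]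

/-- The probability that the walk started at a given vertex visits `j` only after time `t`. -/
def survivalProb (G : SimpleGraph V) (j : V) : ℕ → V → ℝ≥0∞
  | 0 => G.killedStep j 1
  | t + 1 => G.killedStep j (G.survivalProb j t)

open scoped Classical in
theorem firstPassageProb_add_survivalProb_zero (G : SimpleGraph V) (hG : ∀ i, 0 < G.degree i)
    (i j : V) : G.firstPassageProb i j 0 + G.survivalProb j 0 i = 1 := by
  rw [firstPassageProb_zero, survivalProb, killedStep]
  by_cases h : i = j <;> simp [h, sum_transProb, hG]

open scoped Classical in
theorem firstPassageProb_add_survivalProb_succ (G : SimpleGraph V) (hG : ∀ i, 0 < G.degree i)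
    (i j : V) (t : ℕ) :
    G.firstPassageProb i j (t + 1) + G.survivalProb j (t + 1) i = G.survivalProb j t i := by
  induction t generalizing i with
  | zero =>
    rw [firstPassageProb_succ, survivalProb, killedStep, survivalProb, killedStep]
    split_ifs
    · simp
    · rw [← Finset.sum_add_distrib]
      refine Finset.sum_congr rfl fun k _ => ?_
      have := firstPassageProb_add_survivalProb_zero G hG k j
      rw [← mul_add, this, Pi.one_apply]
  | succ t ih =>
    rw [firstPassageProb_succ]
    conv_lhs => rw [survivalProb, killedStep]
    conv_rhs => rw [survivalProb, killedStep]
    split_ifs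
    · simp
    · rw [← Finset.sum_add_distrib]
      refine Finset.sum_congr rfl fun k _ => ?_
      rw [← mul_add, ih]

/-- Stated additively because `ℝ≥0∞` has only truncated subtraction. It serves both for the total
mass of the passage time and for its tails. -/
theorem tsum_eq_of_telescoping {f u : ℕ → ℝ≥0∞} {c : ℝ≥0∞} (h0 : f 0 + u 0 = c)
    (hs : ∀ t, f (t + 1) + u (t + 1) = u t) (hu : Tendsto u atTop (𝓝 0)) : ∑' t, f t = c := by
  have key : ∀ N, ∑ t ∈ Finset.range (N + 1), f t + u N = c := by
    intro N
    induction N with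
    | zero => simpa using h0
    | succ N ih => rw [Finset.sum_range_succ, add_assoc, hs, ih]
  have h1 : Tendsto (fun N => ∑ t ∈ Finset.range (N + 1), f t + u N) atTop
      (𝓝 (∑' t, f t + 0)) :=
    ((ENNReal.tendsto_nat_tsum f).comp (tendsto_add_atTop_nat 1)).add hu
  simp only [key, add_zero] at h1
  exact tendsto_nhds_unique h1 tendsto_const_nhds

/-- Layer-cake formula: E[T] = Σ_s P(T > s). -/
theorem tsum_natCast_mul (f : ℕ → ℝ≥0∞) :
    ∑' t : ℕ, (t : ℝ≥0∞) * f t = ∑' s : ℕ, ∑' t : ℕ, f (t + (s + 1)) := by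
  have h1 : ∀ t : ℕ, (t : ℝ≥0∞) * f t = ∑' s : ℕ, if s < t then f t else 0 := by
    intro t
    rw [tsum_eq_sum (s := Finset.range t) (fun s hs => if_neg (by simpa using hs))]
    rw [Finset.sum_congr rfl (fun s hs => if_pos (Finset.mem_range.1 hs))]
    simp
  simp only [h1]
  rw [ENNReal.tsum_comm]
  refine tsum_congr fun s => ?_
  rw [← ENNReal.summable.sum_add_tsum_nat_add' (k := s + 1)]
  rw [Finset.sum_eq_zero, zero_add]
  · refine tsum_congr fun t => if_pos (by omega)
  · intro t ht
    rw [Finset.mem_range] at ht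
    exact if_neg (by omega)

/-- A finite solution of the first step equations is the mean first passage time. -/
theorem meanFirstPassage_eq_of_killedStep (G : SimpleGraph V) (j : V) (H : V → ℝ≥0∞)
    (hG : ∀ i, ∑ k, G.transProb i k = 1) (hH : ∀ i, H i ≠ ⊤)
    (hstep : H = G.killedStep j 1 + G.killedStep j H)
    (h0 : ∀ i, G.firstPassageProb i j 0 + G.survivalProb j 0 i = 1)
    (hs : ∀ i t, G.firstPassageProb i j (t + 1) + G.survivalProb j (t + 1) i =
      G.survivalProb j t i) (i : V) :
    G.meanFirstPassage i j = H i := by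
  have hu1 : G.killedStep j 1 = G.survivalProb j 0 := rfl
  -- H vanishes at j and P(T > 0) is the indicator of the other vertices, so the total of H is a
  -- valid C. The killed operator preserves this bound, so the remainder after N steps is at most C
  -- · P(T > N).
  obtain ⟨C, hCtop, hC⟩ : ∃ C : ℝ≥0∞, C ≠ ⊤ ∧ H ≤ C • G.survivalProb j 0 := by
    refine ⟨∑ k, H k, by simpa [ENNReal.sum_eq_top] using hH, fun k => ?_⟩
    by_cases hk : k = j
    · rw [hstep]
      simp [killedStep, hk]
    · have : G.survivalProb j 0 k = 1 := by
        simp [survivalProb, killedStep, hk, hG]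
      rw [Pi.smul_apply, this, smul_eq_mul, mul_one]
      exact Finset.single_le_sum (f := H) (fun _ _ => zero_le) (Finset.mem_univ k)
  have hrec : ∀ N, (∑ s ∈ Finset.range N, G.survivalProb j s) +
      (G.killedStep j)^[N] H = H := by
    intro N
    induction N with
    | zero => simp
    | succ N ih =>
      rw [Finset.sum_range_succ', Function.iterate_succ_apply']
      simp only [survivalProb]
      rw [← killedStep_sum, add_right_comm, ← killedStep_add, ih, add_comm, ← hstep]
  have hrem : ∀ N, (G.killedStep j)^[N] H ≤ C • G.survivalProb j N := by
    intro N
    induction N with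
    | zero => simpa using hC
    | succ N ih =>
      rw [Function.iterate_succ_apply', survivalProb, ← killedStep_smul]
      exact killedStep_mono G j ih
  have hrec' : ∀ N, (∑ s ∈ Finset.range N, G.survivalProb j s i) +
      (G.killedStep j)^[N] H i = H i := by
    intro N
    have := congrFun (hrec N) i
    simpa using this
  have hle : ∑' s, G.survivalProb j s i ≤ H i := by
    refine ENNReal.tsum_le_of_sum_range_le fun N => ?_
    rw [← hrec' N]
    exact le_self_add
  -- Finiteness of H makes the survival probabilities summable, hence null; this replaces any appeal
  -- to connectedness.
  have hu : Tendsto (fun s => G.survivalProb j s i) atTop (𝓝 0) :=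
    ENNReal.tendsto_atTop_zero_of_tsum_ne_top (ne_top_of_le_ne_top (hH i) hle)
  have hR : Tendsto (fun N => (G.killedStep j)^[N] H i) atTop (𝓝 0) := by
    have h1 : Tendsto (fun N => C * G.survivalProb j N i) atTop (𝓝 (C * 0)) :=
      ENNReal.Tendsto.const_mul hu (Or.inr hCtop)
    rw [mul_zero] at h1
    exact tendsto_of_tendsto_of_tendsto_of_le_of_le tendsto_const_nhds h1
      (fun _ => zero_le) (fun N => hrem N i)
  have hsum : ∑' s, G.survivalProb j s i = H i := by
    have h1 := (ENNReal.tendsto_nat_tsum (fun s => G.survivalProb j s i)).add hR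
    simp only [hrec', add_zero] at h1
    exact tendsto_nhds_unique h1 tendsto_const_nhds
  -- The passage time is almost surely finite, which removes the `⊤` term from `meanFirstPassage`.
  have htot : ∑' t, G.firstPassageProb i j t = 1 :=
    tsum_eq_of_telescoping (h0 i) (hs i) hu
  have htail : ∀ s, ∑' t, G.firstPassageProb i j (t + (s + 1)) = G.survivalProb j s i := by
    intro s
    refine tsum_eq_of_telescoping (u := fun t => G.survivalProb j (t + (s + 1)) i) ?_ ?_ ?_
    · simpa using hs i s
    · intro t
      have := hs i (t + (s + 1))
      rwa [add_right_comm t 1 (s + 1)]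
    · exact hu.comp (tendsto_add_atTop_nat (s + 1))
  rw [meanFirstPassage, htot, tsum_natCast_mul]
  simp [htail, hsum]

open scoped Classical in
/-- A real solution of the first step equations is the mean first passage time. -/
theorem meanFirstPassage_eq_ofReal (G : SimpleGraph V) (hG : ∀ i, 0 < G.degree i) (j : V)
    (h : V → ℝ) (hj : h j = 0)
    (hstep : ∀ i, i ≠ j → ∑ k ∈ G.neighborFinset i, (h i - h k) = G.degree i) :
    (∀ i, 0 ≤ h i) ∧ ∀ i, G.meanFirstPassage i j = ENNReal.ofReal (h i) := by
  have hpos : ∀ i, 0 ≤ h i := by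
    -- Minimum principle: at a minimum the sum of the differences is at most 0, while away from j it
    -- equals a positive degree.
    obtain ⟨i₀, -, hi₀⟩ := Finset.exists_min_image Finset.univ h ⟨j, Finset.mem_univ j⟩
    have : i₀ = j := by
      by_contra hne
      have h1 := hstep i₀ hne
      have h2 : ∑ k ∈ G.neighborFinset i₀, (h i₀ - h k) ≤ 0 :=
        Finset.sum_nonpos fun k _ => sub_nonpos.2 (hi₀ k (Finset.mem_univ k))
      have h3 : (0 : ℝ) < G.degree i₀ := by exact_mod_cast hG i₀
      linarith
    intro i
    rw [← hj, ← this]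
    exact hi₀ i (Finset.mem_univ i)
  refine ⟨hpos, fun i => ?_⟩
  refine meanFirstPassage_eq_of_killedStep G j (fun i => ENNReal.ofReal (h i))
    (fun i => sum_transProb G i (hG i)) (fun i => ENNReal.ofReal_ne_top) ?_
    (fun i => firstPassageProb_add_survivalProb_zero G hG i j)
    (fun i t => firstPassageProb_add_survivalProb_succ G hG i j t) i
  funext i
  by_cases hi : i = j
  · simp [killedStep, hi, hj]
  · have hd : (0 : ℝ) < G.degree i := by exact_mod_cast hG i
    have h1 := hstep i hi
    rw [Finset.sum_sub_distrib, Finset.sum_const, card_neighborFinset_eq_degree,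
      nsmul_eq_mul] at h1
    have h2 : h i = 1 + (G.degree i : ℝ)⁻¹ * ∑ k ∈ G.neighborFinset i, h k := by
      field_simp
      linarith
    simp only [Pi.add_apply, killedStep, if_neg hi, Pi.one_apply, mul_one,
      sum_transProb G i (hG i)]
    rw [h2, ENNReal.ofReal_add zero_le_one
      (mul_nonneg (inv_nonneg.2 hd.le) (Finset.sum_nonneg fun k _ => hpos k)),
      ENNReal.ofReal_one, ENNReal.ofReal_mul (inv_nonneg.2 hd.le),
      ENNReal.ofReal_sum_of_nonneg (fun k _ => hpos k), ENNReal.ofReal_inv_of_pos hd,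
      ENNReal.ofReal_natCast, Finset.mul_sum, neighborFinset_eq_filter, Finset.sum_filter]
    congr 1
    refine Finset.sum_congr rfl fun k _ => ?_
    unfold transProb
    split_ifs <;> simp

end FirstPassage

/-! ### Resistance, Kemeny's constant and insertion of an edge -/

section Resistance

variable {V : Type*}

open scoped Classical in
/-- The adjacency indicator of `G`. -/
def adjInd (G : SimpleGraph V) (i k : V) : ℝ := if G.Adj i k then 1 else 0

open scoped Classical in
theorem adjInd_sup_fromEdgeSet (G : SimpleGraph V) {u v : V} (huv : u ≠ v) (hadj : ¬ G.Adj u v)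
    (i l : V) :
    (G ⊔ fromEdgeSet {s(u, v)}).adjInd i l = G.adjInd i l +
      ((if i = u then if l = v then 1 else 0 else 0) +
        if i = v then if l = u then 1 else 0 else 0) := by
  have hadj' : ¬ G.Adj v u := fun h => hadj h.symm
  unfold adjInd
  simp only [sup_adj, fromEdgeSet_adj, Set.mem_singleton_iff, Sym2.eq_iff, ne_eq]
  by_cases h1 : i = u
  · by_cases h2 : l = v
    · subst h1 h2
      simp [hadj, huv]
    · subst h1
      simp [huv, h2]
  · by_cases h3 : i = v
    · by_cases h4 : l = u
      · subst h3 h4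
        simp [hadj', huv.symm]
      · subst h3
        simp [h1, h4]
    · simp [h1, h3]

variable [Fintype V]

/-- The degree of a vertex as a real number. -/
def realDegree (G : SimpleGraph V) (i : V) : ℝ := ∑ k, G.adjInd i k

open scoped Classical in
theorem natCast_degree (G : SimpleGraph V) (i : V) : (G.degree i : ℝ) = G.realDegree i := by
  unfold realDegree adjInd
  rw [← Finset.sum_filter, Finset.sum_const, nsmul_eq_mul, mul_one, ← neighborFinset_eq_filter,
    card_neighborFinset_eq_degree]

open scoped Classical in
theorem two_mul_card_edgeFinset_eq_sum_realDegree (G : SimpleGraph V) :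
    2 * (G.edgeFinset.card : ℝ) = ∑ i, G.realDegree i := by
  have h := G.sum_degrees_eq_twice_card_edges
  have h' : ((∑ i, G.degree i : ℕ) : ℝ) = ((2 * G.edgeFinset.card : ℕ) : ℝ) := by
    rw [h]
  push_cast at h'
  rw [← h']
  exact Finset.sum_congr rfl fun i _ => natCast_degree G i

open scoped Classical in
/-- `r` solves the equations that characterize the effective resistance of `G`, with every edge
of unit resistance. -/
structure IsResistance (G : SimpleGraph V) (r : V → V → ℝ) : Prop where
  symm : ∀ i k, r i k = r k i
  diag : ∀ i, r i i = 0
  laplacian : ∃ μ : V → ℝ, ∀ i k,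
    ∑ l, G.adjInd i l * (r i k - r l k) = μ i - if i = k then 2 else 0

/-- The degree-weighted Kirchhoff sum divided by the total degree. -/
def kirchhoffRatio (G : SimpleGraph V) (r : V → V → ℝ) : ℝ :=
  (∑ j, ∑ k, G.realDegree j * G.realDegree k * r j k) / (2 * ∑ j, G.realDegree j)

open scoped Classical in
theorem statDist_eq_ofReal (G : SimpleGraph V) (h : 0 < ∑ i, G.realDegree i) (j : V) :
    G.statDist j = ENNReal.ofReal (G.realDegree j / ∑ i, G.realDegree i) := by
  rw [ENNReal.ofReal_div_of_pos h, statDist, ← natCast_degree, ENNReal.ofReal_natCast,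
    ← two_mul_card_edgeFinset_eq_sum_realDegree, ENNReal.ofReal_mul zero_le_two, ENNReal.ofReal_natCast]
  simp

open scoped Classical in
theorem IsResistance.meanFirstPassage_eq {G : SimpleGraph V} {r : V → V → ℝ}
    (hr : G.IsResistance r) (hG : ∀ i, 0 < G.realDegree i) (j : V) :
    (∀ i, 0 ≤ ∑ k, G.realDegree k * ((r i j + r j k - r i k) / 2)) ∧
    ∀ i, G.meanFirstPassage i j =
      ENNReal.ofReal (∑ k, G.realDegree k * ((r i j + r j k - r i k) / 2)) := by
  obtain ⟨μ, hμ⟩ := hr.laplacian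
  refine meanFirstPassage_eq_ofReal G ?_ j
    (fun i => ∑ k, G.realDegree k * ((r i j + r j k - r i k) / 2)) ?_ ?_
  · intro i
    have := hG i
    rw [← natCast_degree] at this
    exact_mod_cast this
  · refine Finset.sum_eq_zero fun k _ => ?_
    rw [hr.diag]
    ring
  · intro i hij
    rw [natCast_degree]
    have h1 : ∀ f : V → ℝ, ∑ l ∈ G.neighborFinset i, f l = ∑ l, G.adjInd i l * f l := by
      intro f
      rw [neighborFinset_eq_filter, Finset.sum_filter]
      refine Finset.sum_congr rfl fun l _ => ?_
      unfold adjInd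
      split_ifs <;> simp
    rw [h1]
    have h2 : ∀ l, G.adjInd i l * (∑ k, G.realDegree k * ((r i j + r j k - r i k) / 2) -
        ∑ k, G.realDegree k * ((r l j + r j k - r l k) / 2)) =
        ∑ k, G.realDegree k * ((G.adjInd i l * (r i j - r l j)) / 2 -
          (G.adjInd i l * (r i k - r l k)) / 2) := by
      intro l
      rw [← Finset.sum_sub_distrib, Finset.mul_sum]
      refine Finset.sum_congr rfl fun k _ => by ring
    simp only [h2]
    rw [Finset.sum_comm]
    -- The two copies of μ_i cancel and r_jk has already dropped out, so only the 2δ_ik term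
    -- remains. Halved and weighted by d_k, it gives the degree of i.
    simp only [← Finset.mul_sum, Finset.sum_sub_distrib, ← Finset.sum_div, hμ, if_neg hij]
    rw [Finset.sum_eq_single i]
    · rw [if_pos rfl]
      ring
    · intro k _ hk
      rw [if_neg hk.symm]
      ring
    · simp

theorem IsResistance.kemenyFrom_eq {G : SimpleGraph V} {r : V → V → ℝ}
    (hr : G.IsResistance r) (hG : ∀ i, 0 < G.realDegree i) (i : V) :
    G.kemenyFrom i = ENNReal.ofReal (G.kirchhoffRatio r) := by
  have hD : 0 < ∑ i, G.realDegree i :=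
    Finset.sum_pos (fun i _ => hG i) ⟨i, Finset.mem_univ i⟩
  unfold kemenyFrom
  have h1 : ∀ j, G.meanFirstPassage i j * G.statDist j =
      ENNReal.ofReal ((∑ k, G.realDegree k * ((r i j + r j k - r i k) / 2)) *
        (G.realDegree j / ∑ i, G.realDegree i)) := by
    intro j
    rw [ENNReal.ofReal_mul ((hr.meanFirstPassage_eq hG j).1 i),
      (hr.meanFirstPassage_eq hG j).2 i, statDist_eq_ofReal G hD]
  simp only [h1]
  rw [← ENNReal.ofReal_sum_of_nonneg]
  · congr 1
    unfold kirchhoffRatio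
    rw [eq_div_iff (by positivity), Finset.sum_mul]
    have h2 : ∀ j, (∑ k, G.realDegree k * ((r i j + r j k - r i k) / 2)) *
        (G.realDegree j / ∑ i, G.realDegree i) * (2 * ∑ i, G.realDegree i) =
        ∑ k, G.realDegree j * G.realDegree k * r i j +
          ∑ k, G.realDegree j * G.realDegree k * r j k -
          ∑ k, G.realDegree j * G.realDegree k * r i k := by
      intro j
      rw [← Finset.sum_add_distrib, ← Finset.sum_sub_distrib]
      have h3 : (∑ k, G.realDegree k * ((r i j + r j k - r i k) / 2)) *
        (G.realDegree j / ∑ i, G.realDegree i) * (2 * ∑ i, G.realDegree i) =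
        (∑ k, G.realDegree k * ((r i j + r j k - r i k) / 2)) * (2 * G.realDegree j) := by
        field_simp
      rw [h3, Finset.sum_mul]
      refine Finset.sum_congr rfl fun k _ => by ring
    simp only [h2, Finset.sum_add_distrib, Finset.sum_sub_distrib]
    -- The two sums involving the starting vertex agree by symmetry in j and k; this is where the
    -- dependence on i disappears.
    have h4 : ∑ j, ∑ k, G.realDegree j * G.realDegree k * r i j =
        ∑ j, ∑ k, G.realDegree j * G.realDegree k * r i k := by
      rw [Finset.sum_comm]
      refine Finset.sum_congr rfl fun k _ => Finset.sum_congr rfl fun j _ => by ring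
    rw [h4]
    ring
  · intro j _
    exact mul_nonneg ((hr.meanFirstPassage_eq hG j).1 i) (div_nonneg (hG j).le hD.le)

open scoped Classical in
theorem realDegree_sup_fromEdgeSet (G : SimpleGraph V) {u v : V} (huv : u ≠ v)
    (hadj : ¬ G.Adj u v) (i : V) :
    (G ⊔ fromEdgeSet {s(u, v)}).realDegree i =
      G.realDegree i + ((if i = u then 1 else 0) + if i = v then 1 else 0) := by
  unfold realDegree
  simp only [adjInd_sup_fromEdgeSet G huv hadj, Finset.sum_add_distrib]
  congr 1
  by_cases h1 : i = u <;> by_cases h2 : i = v <;> simp [h1, h2]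

/-- The resistance after adding an edge `{u, v}` (Sherman–Morrison formula). -/
def edgeUpdate (r : V → V → ℝ) (u v i k : V) : ℝ :=
  r i k - ((r i u - r i v) - (r k u - r k v)) ^ 2 / (4 * (1 + r u v))

open scoped Classical in
theorem IsResistance.edgeUpdate {G : SimpleGraph V} {r : V → V → ℝ} (hr : G.IsResistance r)
    {u v : V} (huv : u ≠ v) (hadj : ¬ G.Adj u v) (hρ : 0 ≤ r u v) :
    (G ⊔ fromEdgeSet {s(u, v)}).IsResistance (edgeUpdate r u v) := by
  obtain ⟨μ, hμ⟩ := hr.laplacian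
  have hρ' : 1 + r u v ≠ 0 := by positivity
  refine ⟨fun i k => ?_, fun i => ?_, ?_⟩
  · unfold SimpleGraph.edgeUpdate
    rw [hr.symm i k]
    ring
  · unfold SimpleGraph.edgeUpdate
    rw [hr.diag]
    ring
  -- With φ = r(·,u) − r(·,v) and ρ = r_uv, the old edges contribute −4cφ_k at u, and the new edge
  -- contributes φ_k − 4cρφ_k. Their sum φ_k(1 − 4c(1 + ρ)) must vanish, which fixes c; at v the
  -- signs are reversed.
  · set c : ℝ := (4 * (1 + r u v))⁻¹ with hc
    have hc' : c * (4 * (1 + r u v)) = 1 := inv_mul_cancel₀ (by positivity)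
    -- The new μ absorbs the Laplacian of φ², which does not involve k. The old adjacency suffices
    -- because φ_u² = φ_v².
    refine ⟨fun i => μ i - c * ∑ l, G.adjInd i l *
      ((r i u - r i v) ^ 2 - (r l u - r l v) ^ 2), fun i k => ?_⟩
    have e1 : ∀ l, SimpleGraph.edgeUpdate r u v i k - SimpleGraph.edgeUpdate r u v l k =
        (r i k - r l k) - c * ((r i u - r i v) ^ 2 - (r l u - r l v) ^ 2)
        + 2 * c * (r k u - r k v) * ((r i u - r l u) - (r i v - r l v)) := by
      intro l
      unfold SimpleGraph.edgeUpdate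
      rw [div_eq_mul_inv, div_eq_mul_inv, ← hc]
      ring
    have e2 : ∑ l, G.adjInd i l *
        (SimpleGraph.edgeUpdate r u v i k - SimpleGraph.edgeUpdate r u v l k) =
        (μ i - if i = k then 2 else 0) - c * ∑ l, G.adjInd i l *
          ((r i u - r i v) ^ 2 - (r l u - r l v) ^ 2) + 2 * c * (r k u - r k v) *
          ((μ i - if i = u then 2 else 0) - (μ i - if i = v then 2 else 0)) := by
      rw [← hμ i k, ← hμ i u, ← hμ i v]
      simp only [e1, ← Finset.sum_sub_distrib, Finset.mul_sum, ← Finset.sum_add_distrib]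
      refine Finset.sum_congr rfl fun l _ => by ring
    simp only [adjInd_sup_fromEdgeSet G huv hadj, add_mul, Finset.sum_add_distrib]
    rw [e2]
    have e3 : ∀ (p q : V) (f : V → ℝ),
        ∑ l, (if i = p then if l = q then (1 : ℝ) else 0 else 0) * f l =
          if i = p then f q else 0 := by
      intro p q f
      by_cases h : i = p <;> simp [h]
    rw [e3, e3]
    have hvu := hr.symm v u
    by_cases h1 : i = u
    · subst h1
      simp only [if_true, if_neg huv, add_zero, e1, hr.diag, hvu]
      rw [hr.symm k i, hr.symm k v]
      linear_combination (r v k - r i k) * hc'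
    · by_cases h2 : i = v
      · subst h2
        simp only [if_true, if_neg h1, zero_add, e1, hr.diag, hvu]
        rw [hr.symm k i, hr.symm k u]
        linear_combination (r u k - r i k) * hc'
      · simp only [if_neg h1, if_neg h2]
        ring

open scoped Classical in
/-- The degree-weighted Kirchhoff sum after adding an edge. -/
theorem IsResistance.kirchhoffRatio_edgeUpdate {G : SimpleGraph V} {r : V → V → ℝ}
    (hr : G.IsResistance r) {u v : V} (huv : u ≠ v) (hadj : ¬ G.Adj u v) :
    (G ⊔ fromEdgeSet {s(u, v)}).kirchhoffRatio (SimpleGraph.edgeUpdate r u v) =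
      ((∑ j, ∑ k, G.realDegree j * G.realDegree k * r j k) +
        2 * (∑ k, G.realDegree k * r k u + ∑ k, G.realDegree k * r k v) + 2 * r u v -
        2 * ((∑ k, G.realDegree k + 2) *
            (∑ k, G.realDegree k * (r k u - r k v) ^ 2 + 2 * r u v ^ 2) -
          (∑ k, G.realDegree k * r k u - ∑ k, G.realDegree k * r k v) ^ 2) / (4 * (1 + r u v))) /
        (2 * (∑ k, G.realDegree k + 2)) := by
  set d := G.realDegree with hd
  -- Against a measure, the double sum of (φ_j − φ_k)² is 2(mass · second moment − first moment²),
  -- with φ = r(·,u) − r(·,v). The unit masses added at u and v, where φ = ∓r_uv, raise the mass by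
  -- 2 and the second moment by 2r_uv², and leave the first moment unchanged.
  have hsum : ∀ f : V → ℝ, ∑ k, (G ⊔ fromEdgeSet {s(u, v)}).realDegree k * f k =
      ∑ k, d k * f k + f u + f v := by
    intro f
    simp only [realDegree_sup_fromEdgeSet G huv hadj, add_mul, Finset.sum_add_distrib, ite_mul,
      one_mul, zero_mul, Finset.sum_ite_eq', Finset.mem_univ, if_true, add_assoc, hd]
  have hD : ∑ k, (G ⊔ fromEdgeSet {s(u, v)}).realDegree k = ∑ k, d k + 2 := by
    have := hsum (fun _ => 1)
    simp only [mul_one] at this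
    rw [this]
    ring
  unfold kirchhoffRatio
  rw [hD]
  congr 1
  simp only [mul_assoc, ← Finset.mul_sum, hsum]
  have hφ : ∀ j, ∑ k, d k * SimpleGraph.edgeUpdate r u v j k = ∑ k, d k * r j k -
      ((r j u - r j v) ^ 2 * ∑ k, d k - 2 * (r j u - r j v) *
        (∑ k, d k * r k u - ∑ k, d k * r k v) + ∑ k, d k * (r k u - r k v) ^ 2) /
        (4 * (1 + r u v)) := by
    intro j
    unfold SimpleGraph.edgeUpdate
    rw [eq_sub_iff_add_eq, ← Finset.sum_sub_distrib, Finset.mul_sum, Finset.mul_sum,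
      ← Finset.sum_sub_distrib, ← Finset.sum_add_distrib, Finset.sum_div,
      ← Finset.sum_add_distrib]
    refine Finset.sum_congr rfl fun k _ => by ring
  simp only [hφ]
  have hvu := hr.symm v u
  have hsplit : ∑ j, d j * (∑ k, d k * r j k -
      ((r j u - r j v) ^ 2 * ∑ k, d k - 2 * (r j u - r j v) *
        (∑ k, d k * r k u - ∑ k, d k * r k v) + ∑ k, d k * (r k u - r k v) ^ 2) /
        (4 * (1 + r u v)) + SimpleGraph.edgeUpdate r u v j u +
        SimpleGraph.edgeUpdate r u v j v) =
      ∑ j, d j * ∑ k, d k * r j k -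
        ((∑ k, d k * (r k u - r k v) ^ 2) * ∑ k, d k -
          2 * (∑ k, d k * r k u - ∑ k, d k * r k v) *
          (∑ k, d k * r k u - ∑ k, d k * r k v) +
          (∑ k, d k) * ∑ k, d k * (r k u - r k v) ^ 2) / (4 * (1 + r u v)) +
        ∑ k, d k * r k u + ∑ k, d k * r k v -
        (2 * ∑ k, d k * (r k u - r k v) ^ 2 + 2 * r u v ^ 2 * ∑ k, d k) / (4 * (1 + r u v)) := by
    rw [eq_sub_iff_add_eq]
    set F1 := ∑ k, d k * r k u - ∑ k, d k * r k v with hF1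
    set F2 := ∑ k, d k * (r k u - r k v) ^ 2 with hF2
    set D := ∑ k, d k with hDd
    have e : ∀ j, d j * (∑ k, d k * r j k -
      ((r j u - r j v) ^ 2 * D - 2 * (r j u - r j v) * F1 + F2) /
        (4 * (1 + r u v)) + SimpleGraph.edgeUpdate r u v j u +
        SimpleGraph.edgeUpdate r u v j v) =
        d j * ∑ k, d k * r j k
        - (d j * (r j u - r j v) ^ 2) * ((D + 2) / (4 * (1 + r u v)))
        + (d j * r j u) * (2 * F1 / (4 * (1 + r u v)) + 1)
        - (d j * r j v) * (2 * F1 / (4 * (1 + r u v)) - 1)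
        - d j * ((F2 + 2 * r u v ^ 2) / (4 * (1 + r u v))) := by
      intro j
      unfold SimpleGraph.edgeUpdate
      rw [hr.diag, hr.diag, hvu]
      ring
    simp only [e, Finset.sum_add_distrib, Finset.sum_sub_distrib, ← Finset.sum_mul]
    rw [← hF2, ← hDd]
    have hF1' : ∑ k, d k * r k u = F1 + ∑ k, d k * r k v := by rw [hF1]; ring
    rw [hF1']
    ring
  have hsymm : ∀ w, ∑ k, d k * r w k = ∑ k, d k * r k w := fun w =>
    Finset.sum_congr rfl fun k _ => by rw [hr.symm]
  rw [hsplit, hsymm u, hsymm v]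
  unfold SimpleGraph.edgeUpdate
  simp only [hr.diag, hvu]
  ring

end Resistance

/-! ### Braess edges as a polynomial inequality -/

section BraessCriterion

variable {V : Type*} [Fintype V]

/-- A criterion for Braess edges in terms of weighted resistance sums. -/
theorem IsResistance.isBraessEdge_iff [Nonempty V] {G : SimpleGraph V} {r : V → V → ℝ}
    (hr : G.IsResistance r) (hG : ∀ i, 0 < G.realDegree i) {u v : V} (huv : u ≠ v)
    (hadj : ¬ G.Adj u v) (hρ : 0 ≤ r u v) {S D Tu Tv Q : ℝ}
    (hS : ∑ j, ∑ k, G.realDegree j * G.realDegree k * r j k = S) (hS0 : 0 ≤ S)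
    (hD : ∑ k, G.realDegree k = D)
    (hTu : ∑ k, G.realDegree k * r k u = Tu) (hTv : ∑ k, G.realDegree k * r k v = Tv)
    (hQ : ∑ k, G.realDegree k * (r k u - r k v) ^ 2 = Q) :
    G.IsBraessEdge s(u, v) ↔
      4 * (1 + r u v) * S + D * ((D + 2) * (Q + 2 * r u v ^ 2) - (Tu - Tv) ^ 2) <
        4 * (1 + r u v) * D * (Tu + Tv + r u v) := by
  classical
  have hG' : ∀ i, 0 < (G ⊔ fromEdgeSet {s(u, v)}).realDegree i := by
    intro i
    rw [realDegree_sup_fromEdgeSet G huv hadj]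
    have := hG i
    split_ifs <;> linarith
  have hDpos : 0 < D := by
    rw [← hD]
    exact Finset.sum_pos (fun i _ => hG i) Finset.univ_nonempty
  have hK : G.kirchhoffRatio r = S / (2 * D) := by
    rw [kirchhoffRatio, hS, hD]
  unfold IsBraessEdge kemeny
  rw [hr.kemenyFrom_eq hG, (hr.edgeUpdate huv hadj hρ).kemenyFrom_eq hG',
    hr.kirchhoffRatio_edgeUpdate huv hadj, hK, hS, hD, hTu, hTv, hQ,
    ENNReal.ofReal_lt_ofReal_iff_of_nonneg (by positivity)]
  simp only [Sym2.mk_isDiag_iff, huv, not_false_eq_true, mem_edgeSet, hadj, true_and]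
  rw [div_lt_div_iff₀ (by positivity) (by positivity)]
  set ρ := r u v
  have hρ' : 0 < 4 * (1 + ρ) := by positivity
  rw [← mul_lt_mul_iff_left₀ hρ']
  have e : (S + 2 * (Tu + Tv) + 2 * ρ - 2 * ((D + 2) * (Q + 2 * ρ ^ 2) - (Tu - Tv) ^ 2) /
      (4 * (1 + ρ))) * (2 * D) * (4 * (1 + ρ)) =
      ((S + 2 * (Tu + Tv) + 2 * ρ) * (4 * (1 + ρ)) -
        2 * ((D + 2) * (Q + 2 * ρ ^ 2) - (Tu - Tv) ^ 2)) * (2 * D) := by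
    field_simp
  rw [e]
  constructor <;> intro h <;> linarith

end BraessCriterion

/-! ### The spider sum: vertices, distances and adjacency -/

section SpiderSum

/-- Vertices of the one-sum of `S_{1,b₁}` and `S_{2,b₂}` at their centers. -/
abbrev SpiderSumVertex (b₁ b₂ : ℕ) : Type :=
  {x : SpiderVertex 1 b₁ // x ≠ spiderCenter 1 b₁} ⊕ SpiderVertex 2 b₂

/-- The one-sum of `S_{1,b₁}` and `S_{2,b₂}` at their centers. -/
abbrev spiderSum (b₁ b₂ : ℕ) : SimpleGraph (SpiderSumVertex b₁ b₂) :=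
  oneSum (spider 1 b₁) (spider 2 b₂) (spiderCenter 1 b₁) (spiderCenter 2 b₂)

namespace SpiderSumVertex

variable {b₁ b₂ : ℕ}

/-- The end of a leg of length one. -/
def leaf (l : Fin b₁) : SpiderSumVertex b₁ b₂ := Sum.inl ⟨some (l, 0), Option.some_ne_none _⟩

/-- The common center. -/
def center : SpiderSumVertex b₁ b₂ := Sum.inr none

/-- The middle of a leg of length two. -/
def mid (l : Fin b₂) : SpiderSumVertex b₁ b₂ := Sum.inr (some (l, 0))

/-- The end of a leg of length two. -/
def tip (l : Fin b₂) : SpiderSumVertex b₁ b₂ := Sum.inr (some (l, 1))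

theorem exists_eq (x : SpiderSumVertex b₁ b₂) :
    (∃ l, x = leaf l) ∨ x = center ∨ (∃ l, x = mid l) ∨ ∃ l, x = tip l := by
  rcases x with ⟨_ | ⟨l, d⟩, hx⟩ | _ | ⟨l, d⟩
  · exact absurd rfl hx
  · obtain rfl : d = 0 := Subsingleton.elim _ _
    exact Or.inl ⟨l, rfl⟩
  · exact Or.inr (Or.inl rfl)
  · fin_cases d
    · exact Or.inr (Or.inr (Or.inl ⟨l, rfl⟩))
    · exact Or.inr (Or.inr (Or.inr ⟨l, rfl⟩))

theorem leaf_injective : Function.Injective (leaf : Fin b₁ → SpiderSumVertex b₁ b₂) := by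
  intro p q h
  simpa [leaf, Subtype.ext_iff] using h

theorem sum_eq (f : SpiderSumVertex b₁ b₂ → ℝ) :
    ∑ x, f x = ∑ l, f (leaf l) + (f center + ∑ l, (f (mid l) + f (tip l))) := by
  rw [Fintype.sum_sum_type, Fintype.sum_option, Fintype.sum_prod_type]
  simp only [Fin.sum_univ_two]
  congr 1
  have hb : Function.Bijective (fun l : Fin b₁ =>
      (⟨some (l, 0), Option.some_ne_none _⟩ :
        {x : SpiderVertex 1 b₁ // x ≠ spiderCenter 1 b₁})) := by
    constructor
    · intro p q h
      simpa [Subtype.ext_iff] using h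
    · rintro ⟨_ | ⟨l, d⟩, hx⟩
      · exact absurd rfl hx
      · obtain rfl : d = 0 := Subsingleton.elim _ _
        exact ⟨l, rfl⟩
  exact (hb.sum_comp fun x => f (Sum.inl x)).symm

/-- The distance in `spiderSum`. -/
def treeDist : SpiderSumVertex b₁ b₂ → SpiderSumVertex b₁ b₂ → ℝ
  | Sum.inl x, Sum.inl y => if x = y then 0 else 2
  | Sum.inl _, Sum.inr none => 1
  | Sum.inr none, Sum.inl _ => 1
  | Sum.inl _, Sum.inr (some y) => y.2.val + 2
  | Sum.inr (some x), Sum.inl _ => x.2.val + 2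
  | Sum.inr none, Sum.inr none => 0
  | Sum.inr none, Sum.inr (some y) => y.2.val + 1
  | Sum.inr (some x), Sum.inr none => x.2.val + 1
  | Sum.inr (some x), Sum.inr (some y) =>
    if x.1 = y.1 then |(x.2.val : ℝ) - y.2.val| else x.2.val + y.2.val + 2

theorem treeDist_leaf_leaf (p q : Fin b₁) :
    treeDist (leaf p : SpiderSumVertex b₁ b₂) (leaf q) = if p = q then 0 else 2 := by
  simp [treeDist, leaf, Subtype.ext_iff]

theorem treeDist_leaf_center (p : Fin b₁) :
    treeDist (leaf p : SpiderSumVertex b₁ b₂) center = 1 := rfl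

theorem treeDist_center_leaf (p : Fin b₁) :
    treeDist center (leaf p : SpiderSumVertex b₁ b₂) = 1 := rfl

theorem treeDist_leaf_mid (p : Fin b₁) (q : Fin b₂) : treeDist (leaf p) (mid q) = 2 := by
  simp [treeDist, leaf, mid]

theorem treeDist_mid_leaf (p : Fin b₁) (q : Fin b₂) : treeDist (mid q) (leaf p) = 2 := by
  simp [treeDist, leaf, mid]

theorem treeDist_leaf_tip (p : Fin b₁) (q : Fin b₂) : treeDist (leaf p) (tip q) = 3 := by
  norm_num [treeDist, leaf, tip]

theorem treeDist_tip_leaf (p : Fin b₁) (q : Fin b₂) : treeDist (tip q) (leaf p) = 3 := by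
  norm_num [treeDist, leaf, tip]

theorem treeDist_center_center :
    treeDist (center : SpiderSumVertex b₁ b₂) center = 0 := rfl

theorem treeDist_center_mid (q : Fin b₂) :
    treeDist (center : SpiderSumVertex b₁ b₂) (mid q) = 1 := by
  simp [treeDist, center, mid]

theorem treeDist_mid_center (q : Fin b₂) :
    treeDist (mid q : SpiderSumVertex b₁ b₂) center = 1 := by
  simp [treeDist, center, mid]

theorem treeDist_center_tip (q : Fin b₂) :
    treeDist (center : SpiderSumVertex b₁ b₂) (tip q) = 2 := by
  norm_num [treeDist, center, tip]

theorem treeDist_tip_center (q : Fin b₂) :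
    treeDist (tip q : SpiderSumVertex b₁ b₂) center = 2 := by
  norm_num [treeDist, center, tip]

theorem treeDist_mid_mid (p q : Fin b₂) :
    treeDist (mid p : SpiderSumVertex b₁ b₂) (mid q) = if p = q then 0 else 2 := by
  simp [treeDist, mid]

theorem treeDist_mid_tip (p q : Fin b₂) :
    treeDist (mid p : SpiderSumVertex b₁ b₂) (tip q) = if p = q then 1 else 3 := by
  norm_num [treeDist, mid, tip]

theorem treeDist_tip_mid (p q : Fin b₂) :
    treeDist (tip p : SpiderSumVertex b₁ b₂) (mid q) = if p = q then 1 else 3 := by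
  norm_num [treeDist, mid, tip]

theorem treeDist_tip_tip (p q : Fin b₂) :
    treeDist (tip p : SpiderSumVertex b₁ b₂) (tip q) = if p = q then 0 else 4 := by
  norm_num [treeDist, tip]

theorem adj_leaf_leaf (p q : Fin b₁) : (spiderSum b₁ b₂).Adj (leaf p) (leaf q) ↔ False := by
  simp [oneSum, spider, leaf]

theorem adj_leaf_center (p : Fin b₁) : (spiderSum b₁ b₂).Adj (leaf p) center ↔ True := by
  simp [oneSum, spider, leaf, center, spiderCenter]

theorem adj_center_leaf (p : Fin b₁) : (spiderSum b₁ b₂).Adj center (leaf p) ↔ True := by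
  simp [oneSum, spider, leaf, center, spiderCenter]

theorem adj_leaf_mid (p : Fin b₁) (q : Fin b₂) :
    (spiderSum b₁ b₂).Adj (leaf p) (mid q) ↔ False := by
  simp [oneSum, leaf, mid, spiderCenter]

theorem adj_mid_leaf (p : Fin b₁) (q : Fin b₂) :
    (spiderSum b₁ b₂).Adj (mid q) (leaf p) ↔ False := by
  simp [oneSum, leaf, mid, spiderCenter]

theorem adj_leaf_tip (p : Fin b₁) (q : Fin b₂) :
    (spiderSum b₁ b₂).Adj (leaf p) (tip q) ↔ False := by
  simp [oneSum, leaf, tip, spiderCenter]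

theorem adj_tip_leaf (p : Fin b₁) (q : Fin b₂) :
    (spiderSum b₁ b₂).Adj (tip q) (leaf p) ↔ False := by
  simp [oneSum, leaf, tip, spiderCenter]

theorem adj_center_center : (spiderSum b₁ b₂).Adj center center ↔ False := by
  simp

theorem adj_center_mid (q : Fin b₂) : (spiderSum b₁ b₂).Adj center (mid q) ↔ True := by
  simp [oneSum, spider, mid, center]

theorem adj_mid_center (q : Fin b₂) : (spiderSum b₁ b₂).Adj (mid q) center ↔ True := by
  simp [oneSum, spider, mid, center]

theorem adj_center_tip (q : Fin b₂) : (spiderSum b₁ b₂).Adj center (tip q) ↔ False := by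
  simp [oneSum, spider, tip, center]

theorem adj_tip_center (q : Fin b₂) : (spiderSum b₁ b₂).Adj (tip q) center ↔ False := by
  simp [oneSum, spider, tip, center]

theorem adj_mid_mid (p q : Fin b₂) : (spiderSum b₁ b₂).Adj (mid p) (mid q) ↔ False := by
  simp [oneSum, spider, mid]

theorem adj_mid_tip (p q : Fin b₂) : (spiderSum b₁ b₂).Adj (mid p) (tip q) ↔ p = q := by
  simp [oneSum, spider, mid, tip]

theorem adj_tip_mid (p q : Fin b₂) : (spiderSum b₁ b₂).Adj (tip p) (mid q) ↔ p = q := by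
  simp [oneSum, spider, mid, tip]

theorem adj_tip_tip (p q : Fin b₂) : (spiderSum b₁ b₂).Adj (tip p) (tip q) ↔ False := by
  simp [oneSum, spider, tip]

theorem realDegree_leaf (p : Fin b₁) : (spiderSum b₁ b₂).realDegree (leaf p) = 1 := by
  simp only [realDegree, sum_eq, adjInd, adj_leaf_leaf, adj_leaf_center, adj_leaf_mid,
    adj_leaf_tip]
  simp

theorem realDegree_center : (spiderSum b₁ b₂).realDegree center = b₁ + b₂ := by
  simp only [realDegree, sum_eq, adjInd, adj_center_leaf, adj_center_center, adj_center_mid,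
    adj_center_tip]
  simp

theorem realDegree_mid (p : Fin b₂) : (spiderSum b₁ b₂).realDegree (mid p) = 2 := by
  simp only [realDegree, sum_eq, adjInd, adj_mid_leaf, adj_mid_center, adj_mid_mid, adj_mid_tip]
  norm_num

theorem realDegree_tip (p : Fin b₂) : (spiderSum b₁ b₂).realDegree (tip p) = 1 := by
  simp only [realDegree, sum_eq, adjInd, adj_tip_leaf, adj_tip_center, adj_tip_mid, adj_tip_tip]
  simp

theorem realDegree_pos (hb₁ : 1 ≤ b₁) (x : SpiderSumVertex b₁ b₂) :
    0 < (spiderSum b₁ b₂).realDegree x := by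
  rcases exists_eq x with ⟨p, rfl⟩ | rfl | ⟨p, rfl⟩ | ⟨p, rfl⟩
  · simp [realDegree_leaf]
  · rw [realDegree_center]
    have : (1 : ℝ) ≤ b₁ := by exact_mod_cast hb₁
    positivity
  · simp [realDegree_mid]
  · simp [realDegree_tip]

/-- All legs not containing u or v contribute equally, so each leg sum reduces to one or two
exceptional terms. The subtraction is in ℝ, so the results feed directly into `ring`. -/
theorem sum_fin_eq_of_eq_off_singleton {b : ℕ} (f : Fin b → ℝ) (a : ℝ) (p : Fin b)
    (h : ∀ l, l ≠ p → f l = a) : ∑ l, f l = f p + (b - 1) * a := by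
  have h1 : ∑ l, (f l - a) = f p - a :=
    Finset.sum_eq_single p (fun l _ hl => by rw [h l hl, sub_self]) (by simp)
  rw [Finset.sum_sub_distrib, Finset.sum_const, Finset.card_univ, Fintype.card_fin,
    nsmul_eq_mul] at h1
  linarith

theorem sum_fin_eq_of_eq_off_pair {b : ℕ} (f : Fin b → ℝ) (a : ℝ) {p q : Fin b} (hpq : p ≠ q)
    (h : ∀ l, l ≠ p → l ≠ q → f l = a) : ∑ l, f l = f p + f q + (b - 2) * a := by
  have h1 : ∑ l, (f l - a) = (f p - a) + (f q - a) :=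
    Finset.sum_eq_add p q hpq (fun l _ hl => by rw [h l hl.1 hl.2, sub_self]) (by simp) (by simp)
  rw [Finset.sum_sub_distrib, Finset.sum_const, Finset.card_univ, Fintype.card_fin,
    nsmul_eq_mul] at h1
  linarith

theorem treeDist_symm (x y : SpiderSumVertex b₁ b₂) : treeDist x y = treeDist y x := by
  rcases exists_eq x with ⟨p, rfl⟩ | rfl | ⟨p, rfl⟩ | ⟨p, rfl⟩ <;>
    rcases exists_eq y with ⟨q, rfl⟩ | rfl | ⟨q, rfl⟩ | ⟨q, rfl⟩ <;>
    simp only [treeDist_leaf_leaf, treeDist_leaf_center, treeDist_leaf_mid, treeDist_leaf_tip,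
      treeDist_center_leaf, treeDist_center_center, treeDist_center_mid, treeDist_center_tip,
      treeDist_mid_leaf, treeDist_mid_center, treeDist_mid_mid, treeDist_mid_tip,
      treeDist_tip_leaf, treeDist_tip_center, treeDist_tip_mid, treeDist_tip_tip]
  all_goals exact if_congr eq_comm rfl rfl

theorem treeDist_self (x : SpiderSumVertex b₁ b₂) : treeDist x x = 0 := by
  rcases exists_eq x with ⟨p, rfl⟩ | rfl | ⟨p, rfl⟩ | ⟨p, rfl⟩
  · simp [treeDist_leaf_leaf]
  · exact treeDist_center_center
  · simp [treeDist_mid_mid]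
  · simp [treeDist_tip_tip]

/-- In any tree, a vertex i ≠ k has one neighbour closer to k and deg i − 1 farther, giving 1 − (deg
i − 1) = 2 − deg i; for i = k all neighbours are farther, giving −deg i. Thus μ = 2 − deg. -/
theorem isResistance_treeDist : (spiderSum b₁ b₂).IsResistance treeDist := by
  classical
  refine ⟨treeDist_symm, treeDist_self, fun i => 2 - (spiderSum b₁ b₂).realDegree i, ?_⟩
  intro i k
  rcases exists_eq i with ⟨p, rfl⟩ | rfl | ⟨p, rfl⟩ | ⟨p, rfl⟩
  · simp only [sum_eq, adjInd, adj_leaf_leaf, adj_leaf_center, adj_leaf_mid, adj_leaf_tip,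
      realDegree_leaf, if_true, if_false, zero_mul, one_mul, Finset.sum_const_zero, add_zero,
      zero_add]
    rcases exists_eq k with ⟨q, rfl⟩ | rfl | ⟨q, rfl⟩ | ⟨q, rfl⟩
    · rw [treeDist_leaf_leaf, treeDist_center_leaf]
      simp only [leaf_injective.eq_iff]
      split_ifs <;> norm_num
    · rw [treeDist_leaf_center, treeDist_center_center, if_neg (by simp [leaf, center])]
      norm_num
    · rw [treeDist_leaf_mid, treeDist_center_mid, if_neg (by simp [leaf, mid])]
      norm_num
    · rw [treeDist_leaf_tip, treeDist_center_tip, if_neg (by simp [leaf, tip])]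
      norm_num
  · simp only [sum_eq, adjInd, adj_center_leaf, adj_center_center, adj_center_mid,
      adj_center_tip, realDegree_center, if_true, if_false, zero_mul, one_mul, add_zero,
      zero_add]
    rcases exists_eq k with ⟨q, rfl⟩ | rfl | ⟨q, rfl⟩ | ⟨q, rfl⟩
    · simp only [treeDist_leaf_leaf, treeDist_center_leaf, treeDist_mid_leaf]
      rw [sum_fin_eq_of_eq_off_singleton _ (-1) q (fun l hl => by rw [if_neg hl]; norm_num),
        if_pos rfl, if_neg (by simp [leaf, center])]
      simp
      ring
    · simp only [treeDist_leaf_center, treeDist_center_center, treeDist_mid_center]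
      simp
      ring
    · simp only [treeDist_leaf_mid, treeDist_center_mid, treeDist_mid_mid]
      rw [sum_fin_eq_of_eq_off_singleton (b := b₂) _ (-1) q
        (fun l hl => by rw [if_neg hl]; norm_num), if_pos rfl, if_neg (by simp [mid, center])]
      simp
      ring
    · simp only [treeDist_leaf_tip, treeDist_center_tip, treeDist_mid_tip]
      rw [sum_fin_eq_of_eq_off_singleton (b := b₂) _ (-1) q
        (fun l hl => by rw [if_neg hl]; norm_num), if_pos rfl, if_neg (by simp [tip, center])]
      simp
      ring
  · simp only [sum_eq, adjInd, adj_mid_leaf, adj_mid_center, adj_mid_mid, adj_mid_tip,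
      realDegree_mid, if_true, if_false, zero_mul, one_mul, Finset.sum_const_zero,
      zero_add, ite_mul, Finset.sum_ite_eq, Finset.mem_univ]
    rcases exists_eq k with ⟨q, rfl⟩ | rfl | ⟨q, rfl⟩ | ⟨q, rfl⟩
    · rw [treeDist_mid_leaf, treeDist_center_leaf, treeDist_tip_leaf,
        if_neg (by simp [leaf, mid])]
      norm_num
    · rw [treeDist_mid_center, treeDist_center_center, treeDist_tip_center,
        if_neg (by simp [center, mid])]
      norm_num
    · rw [treeDist_mid_mid, treeDist_center_mid, treeDist_tip_mid]
      by_cases h : p = q <;> norm_num [h, mid]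
    · rw [treeDist_mid_tip, treeDist_center_tip, treeDist_tip_tip]
      by_cases h : p = q <;> norm_num [h, mid, tip]
  · simp only [sum_eq, adjInd, adj_tip_leaf, adj_tip_center, adj_tip_mid, adj_tip_tip,
      realDegree_tip, if_true, if_false, zero_mul, one_mul, Finset.sum_const_zero, add_zero,
      zero_add, ite_mul, Finset.sum_ite_eq, Finset.mem_univ]
    rcases exists_eq k with ⟨q, rfl⟩ | rfl | ⟨q, rfl⟩ | ⟨q, rfl⟩
    · rw [treeDist_mid_leaf, treeDist_tip_leaf, if_neg (by simp [leaf, tip])]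
      norm_num
    · rw [treeDist_mid_center, treeDist_tip_center, if_neg (by simp [center, tip])]
      norm_num
    · rw [treeDist_mid_mid, treeDist_tip_mid]
      by_cases h : p = q <;> norm_num [h, mid, tip]
    · rw [treeDist_mid_tip, treeDist_tip_tip]
      by_cases h : p = q <;> norm_num [h, tip]

/-! ### Degree-weighted distance sums D, T, S and Q -/

theorem sum_realDegree : ∑ x, (spiderSum b₁ b₂).realDegree x = 2 * b₁ + 4 * b₂ := by
  simp only [sum_eq, realDegree_leaf, realDegree_center, realDegree_mid, realDegree_tip,
    Finset.sum_const, Finset.card_univ, Fintype.card_fin, nsmul_eq_mul]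
  ring

theorem sum_treeDist_leaf (p : Fin b₁) :
    ∑ x, (spiderSum b₁ b₂).realDegree x * treeDist x (leaf p) = 3 * b₁ + 8 * b₂ - 2 := by
  simp only [sum_eq, realDegree_leaf, realDegree_center, realDegree_mid, realDegree_tip,
    treeDist_leaf_leaf, treeDist_center_leaf, treeDist_mid_leaf, treeDist_tip_leaf,
    Finset.sum_const, Finset.card_univ, Fintype.card_fin, nsmul_eq_mul]
  rw [sum_fin_eq_of_eq_off_singleton _ 2 p (fun l hl => by rw [if_neg hl]; norm_num), if_pos rfl]
  ring

theorem sum_treeDist_center :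
    ∑ x, (spiderSum b₁ b₂).realDegree x * treeDist x center = b₁ + 4 * b₂ := by
  simp only [sum_eq, realDegree_leaf, realDegree_center, realDegree_mid, realDegree_tip,
    treeDist_leaf_center, treeDist_center_center, treeDist_mid_center, treeDist_tip_center,
    Finset.sum_const, Finset.card_univ, Fintype.card_fin, nsmul_eq_mul]
  ring

theorem sum_treeDist_mid (p : Fin b₂) :
    ∑ x, (spiderSum b₁ b₂).realDegree x * treeDist x (mid p) = 3 * b₁ + 8 * b₂ - 6 := by
  simp only [sum_eq, realDegree_leaf, realDegree_center, realDegree_mid, realDegree_tip,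
    treeDist_leaf_mid, treeDist_center_mid, treeDist_mid_mid, treeDist_tip_mid,
    Finset.sum_const, Finset.card_univ, Fintype.card_fin, nsmul_eq_mul]
  -- Another long leg contributes 2·2 + 1·3 = 7, from its middle and its tip.
  rw [sum_fin_eq_of_eq_off_singleton (b := b₂) _ 7 p
    (fun l hl => by rw [if_neg hl, if_neg hl]; norm_num), if_pos rfl, if_pos rfl]
  ring

theorem sum_treeDist_tip (p : Fin b₂) :
    ∑ x, (spiderSum b₁ b₂).realDegree x * treeDist x (tip p) = 5 * b₁ + 12 * b₂ - 8 := by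
  simp only [sum_eq, realDegree_leaf, realDegree_center, realDegree_mid, realDegree_tip,
    treeDist_leaf_tip, treeDist_center_tip, treeDist_mid_tip, treeDist_tip_tip,
    Finset.sum_const, Finset.card_univ, Fintype.card_fin, nsmul_eq_mul]
  rw [sum_fin_eq_of_eq_off_singleton (b := b₂) _ 10 p
    (fun l hl => by rw [if_neg hl, if_neg hl]; norm_num), if_pos rfl, if_pos rfl]
  ring

theorem sum_sum_treeDist :
    ∑ x, ∑ y, (spiderSum b₁ b₂).realDegree x * (spiderSum b₁ b₂).realDegree y * treeDist x y =
      4 * (b₁ + 2 * b₂) * (b₁ + 4 * b₂) - 2 * b₁ - 20 * b₂ := by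
  have h : ∀ x : SpiderSumVertex b₁ b₂, ∑ y, (spiderSum b₁ b₂).realDegree x *
      (spiderSum b₁ b₂).realDegree y * treeDist x y = (spiderSum b₁ b₂).realDegree x *
      ∑ y, (spiderSum b₁ b₂).realDegree y * treeDist y x := by
    intro x
    rw [Finset.mul_sum]
    refine Finset.sum_congr rfl fun y _ => by rw [treeDist_symm, mul_assoc]
  simp only [h]
  rw [sum_eq]
  simp only [sum_treeDist_leaf, sum_treeDist_center, sum_treeDist_mid, sum_treeDist_tip,
    realDegree_leaf, realDegree_center, realDegree_mid, realDegree_tip,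
    Finset.sum_const, Finset.card_univ, Fintype.card_fin, nsmul_eq_mul]
  ring

theorem sum_sq_leaf_leaf {p q : Fin b₁} (hpq : p ≠ q) :
    ∑ x, (spiderSum b₁ b₂).realDegree x * (treeDist x (leaf p) - treeDist x (leaf q)) ^ 2 = 8 := by
  simp only [sum_eq, realDegree_leaf, realDegree_center, realDegree_mid, realDegree_tip,
    treeDist_leaf_leaf, treeDist_center_leaf, treeDist_mid_leaf, treeDist_tip_leaf]
  rw [sum_fin_eq_of_eq_off_pair _ 0 hpq (fun l h1 h2 => by simp [h1, h2])]
  norm_num [hpq, hpq.symm]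

theorem sum_sq_leaf_mid (p : Fin b₁) (q : Fin b₂) :
    ∑ x, (spiderSum b₁ b₂).realDegree x * (treeDist x (leaf p) - treeDist x (mid q)) ^ 2 = 16 := by
  simp only [sum_eq, realDegree_leaf, realDegree_center, realDegree_mid, realDegree_tip,
    treeDist_leaf_leaf, treeDist_center_leaf, treeDist_mid_leaf, treeDist_tip_leaf,
    treeDist_leaf_mid, treeDist_center_mid, treeDist_mid_mid, treeDist_tip_mid]
  rw [sum_fin_eq_of_eq_off_singleton (b := b₁) _ 0 p (fun l h => by simp [h]),
    sum_fin_eq_of_eq_off_singleton (b := b₂) _ 0 q (fun l h => by simp [h])]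
  norm_num

theorem sum_sq_leaf_tip (p : Fin b₁) (q : Fin b₂) :
    ∑ x, (spiderSum b₁ b₂).realDegree x * (treeDist x (leaf p) - treeDist x (tip q)) ^ 2 =
      2 * b₁ + 4 * b₂ + 16 := by
  simp only [sum_eq, realDegree_leaf, realDegree_center, realDegree_mid, realDegree_tip,
    treeDist_leaf_leaf, treeDist_center_leaf, treeDist_mid_leaf, treeDist_tip_leaf,
    treeDist_leaf_tip, treeDist_center_tip, treeDist_mid_tip, treeDist_tip_tip]
  rw [sum_fin_eq_of_eq_off_singleton (b := b₁) _ 1 p (fun l h => by norm_num [h]),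
    sum_fin_eq_of_eq_off_singleton (b := b₂) _ 3 q (fun l h => by norm_num [h])]
  norm_num
  ring

theorem sum_sq_mid_mid {p q : Fin b₂} (hpq : p ≠ q) :
    ∑ x, (spiderSum b₁ b₂).realDegree x * (treeDist x (mid p) - treeDist x (mid q)) ^ 2 = 24 := by
  simp only [sum_eq, realDegree_leaf, realDegree_center, realDegree_mid, realDegree_tip,
    treeDist_leaf_mid, treeDist_center_mid, treeDist_mid_mid, treeDist_tip_mid]
  rw [sum_fin_eq_of_eq_off_pair (b := b₂) _ 0 hpq (fun l h1 h2 => by simp [h1, h2])]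
  norm_num [hpq, hpq.symm]

theorem sum_sq_mid_tip {p q : Fin b₂} (hpq : p ≠ q) :
    ∑ x, (spiderSum b₁ b₂).realDegree x * (treeDist x (mid p) - treeDist x (tip q)) ^ 2 =
      2 * b₁ + 4 * b₂ + 32 := by
  simp only [sum_eq, realDegree_leaf, realDegree_center, realDegree_mid, realDegree_tip,
    treeDist_leaf_mid, treeDist_center_mid, treeDist_mid_mid, treeDist_tip_mid,
    treeDist_leaf_tip, treeDist_center_tip, treeDist_mid_tip, treeDist_tip_tip]
  rw [sum_fin_eq_of_eq_off_pair (b := b₂) _ 3 hpq (fun l h1 h2 => by norm_num [h1, h2])]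
  norm_num [hpq, hpq.symm]
  ring

theorem sum_sq_tip_tip {p q : Fin b₂} (hpq : p ≠ q) :
    ∑ x, (spiderSum b₁ b₂).realDegree x * (treeDist x (tip p) - treeDist x (tip q)) ^ 2 = 48 := by
  simp only [sum_eq, realDegree_leaf, realDegree_center, realDegree_mid, realDegree_tip,
    treeDist_leaf_tip, treeDist_center_tip, treeDist_mid_tip, treeDist_tip_tip]
  rw [sum_fin_eq_of_eq_off_pair (b := b₂) _ 0 hpq (fun l h1 h2 => by simp [h1, h2])]
  norm_num [hpq, hpq.symm]

theorem sum_sq_center_tip (q : Fin b₂) :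
    ∑ x, (spiderSum b₁ b₂).realDegree x * (treeDist x center - treeDist x (tip q)) ^ 2 =
      8 * b₁ + 16 * b₂ - 8 := by
  simp only [sum_eq, realDegree_leaf, realDegree_center, realDegree_mid, realDegree_tip,
    treeDist_leaf_center, treeDist_center_center, treeDist_mid_center, treeDist_tip_center,
    treeDist_leaf_tip, treeDist_center_tip, treeDist_mid_tip, treeDist_tip_tip]
  -- Another long leg contributes 2·(1 − 3)² + (2 − 4)² = 12.
  rw [sum_fin_eq_of_eq_off_singleton (b := b₂) _ 12 q (fun l h => by norm_num [h])]
  norm_num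
  ring

/-- Lets the criterion compare `ENNReal.ofReal` values as reals. After expansion, 4b₁² absorbs 2b₁
and 24b₁b₂ absorbs 20b₂. -/
theorem sum_sum_treeDist_nonneg (hb₁ : 1 ≤ b₁) :
    (0 : ℝ) ≤ 4 * (b₁ + 2 * b₂) * (b₁ + 4 * b₂) - 2 * b₁ - 20 * b₂ := by
  have h1 : (1 : ℝ) ≤ b₁ := by exact_mod_cast hb₁
  have h2 : (0 : ℝ) ≤ b₂ := by positivity
  nlinarith [mul_nonneg h2 (sub_nonneg.2 h1),
    mul_nonneg (sub_nonneg.2 h1) (sub_nonneg.2 h1), sq_nonneg (b₂ : ℝ)]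

/-! ### Deciding each kind of nonadjacent pair, then counting -/

section Braess

variable [Nonempty (SpiderSumVertex b₁ b₂)]

theorem isBraessEdge_leaf_leaf (hb₂ : 1 ≤ b₂) {p q : Fin b₁} (hpq : p ≠ q) :
    (spiderSum b₁ b₂).IsBraessEdge s(leaf p, leaf q) := by
  have hb : 2 ≤ b₁ := by
    have h1 := p.2
    have h2 := q.2
    have h3 := Fin.val_ne_of_ne hpq
    omega
  have h1 : (2 : ℝ) ≤ b₁ := by exact_mod_cast hb
  have h2 : (1 : ℝ) ≤ b₂ := by exact_mod_cast hb₂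
  have hρ : treeDist (leaf p : SpiderSumVertex b₁ b₂) (leaf q) = 2 := by
    rw [treeDist_leaf_leaf, if_neg hpq]
  rw [isResistance_treeDist.isBraessEdge_iff (realDegree_pos (by omega))
    (leaf_injective.ne hpq) (by simp only [adj_leaf_leaf, not_false_eq_true])
    (by rw [hρ]; norm_num) sum_sum_treeDist (sum_sum_treeDist_nonneg (by omega))
    sum_realDegree (sum_treeDist_leaf p) (sum_treeDist_leaf q) (sum_sq_leaf_leaf hpq), hρ]
  -- Right minus left is 8D(D − 7) + 24b₁ + 240b₂ with D = 2b₁ + 4b₂ ≥ 8.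
  nlinarith [mul_nonneg (sub_nonneg.2 h1) (sub_nonneg.2 h2),
    sq_nonneg ((b₁ : ℝ) - 2), sq_nonneg ((b₂ : ℝ) - 1)]

theorem not_isBraessEdge_leaf_mid (hb₁ : 1 ≤ b₁) (hb₂ : 1 ≤ b₂) (p : Fin b₁) (q : Fin b₂) :
    ¬ (spiderSum b₁ b₂).IsBraessEdge s(leaf p, mid q) := by
  have h1 : (1 : ℝ) ≤ b₁ := by exact_mod_cast hb₁
  have h2 : (1 : ℝ) ≤ b₂ := by exact_mod_cast hb₂
  rw [isResistance_treeDist.isBraessEdge_iff (realDegree_pos hb₁) (by simp [leaf, mid])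
    (by simp only [adj_leaf_mid, not_false_eq_true])
    (by rw [treeDist_leaf_mid]; norm_num) sum_sum_treeDist (sum_sum_treeDist_nonneg hb₁)
    sum_realDegree (sum_treeDist_leaf p) (sum_treeDist_mid q) (sum_sq_leaf_mid p q),
    treeDist_leaf_mid]
  -- The quadratic terms cancel: left minus right is 184b₁ + 176b₂.
  nlinarith [mul_nonneg (sub_nonneg.2 h1) (sub_nonneg.2 h2),
    sq_nonneg ((b₁ : ℝ) - 1), sq_nonneg ((b₂ : ℝ) - 1)]

theorem not_isBraessEdge_leaf_tip (hb₁ : 1 ≤ b₁) (hb₂ : 1 ≤ b₂) (p : Fin b₁) (q : Fin b₂) :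
    ¬ (spiderSum b₁ b₂).IsBraessEdge s(leaf p, tip q) := by
  have h1 : (1 : ℝ) ≤ b₁ := by exact_mod_cast hb₁
  have h2 : (1 : ℝ) ≤ b₂ := by exact_mod_cast hb₂
  rw [isResistance_treeDist.isBraessEdge_iff (realDegree_pos hb₁) (by simp [leaf, tip])
    (by simp only [adj_leaf_tip, not_false_eq_true])
    (by rw [treeDist_leaf_tip]; norm_num) sum_sum_treeDist (sum_sum_treeDist_nonneg hb₁)
    sum_realDegree (sum_treeDist_leaf p) (sum_treeDist_tip q) (sum_sq_leaf_tip p q),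
    treeDist_leaf_tip]
  -- Again only linear terms remain: left minus right is 256(b₁ + b₂).
  nlinarith [mul_nonneg (sub_nonneg.2 h1) (sub_nonneg.2 h2),
    sq_nonneg ((b₁ : ℝ) - 1), sq_nonneg ((b₂ : ℝ) - 1)]

theorem not_isBraessEdge_mid_mid (hb₁ : 1 ≤ b₁) (hb₂ : 1 ≤ b₂) {p q : Fin b₂} (hpq : p ≠ q) :
    ¬ (spiderSum b₁ b₂).IsBraessEdge s(mid p, mid q) := by
  have h1 : (1 : ℝ) ≤ b₁ := by exact_mod_cast hb₁
  have h2 : (1 : ℝ) ≤ b₂ := by exact_mod_cast hb₂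
  have hρ : treeDist (mid p : SpiderSumVertex b₁ b₂) (mid q) = 2 := by
    rw [treeDist_mid_mid, if_neg hpq]
  rw [isResistance_treeDist.isBraessEdge_iff (realDegree_pos hb₁) (by simpa [mid] using hpq)
    (by simp only [adj_mid_mid, not_false_eq_true])
    (by rw [hρ]; norm_num) sum_sum_treeDist (sum_sum_treeDist_nonneg hb₁)
    sum_realDegree (sum_treeDist_mid p) (sum_treeDist_mid q) (sum_sq_mid_mid hpq), hρ]
  -- Left minus right is 8D² + 184D − 24b₁ − 240b₂ with D = 2b₁ + 4b₂.
  nlinarith [mul_nonneg (sub_nonneg.2 h1) (sub_nonneg.2 h2),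
    sq_nonneg ((b₁ : ℝ) - 1), sq_nonneg ((b₂ : ℝ) - 1)]

theorem not_isBraessEdge_mid_tip (hb₁ : 1 ≤ b₁) (hb₂ : 1 ≤ b₂) (p q : Fin b₂) :
    ¬ (spiderSum b₁ b₂).IsBraessEdge s(mid p, tip q) := by
  have h1 : (1 : ℝ) ≤ b₁ := by exact_mod_cast hb₁
  have h2 : (1 : ℝ) ≤ b₂ := by exact_mod_cast hb₂
  by_cases hpq : p = q
  · rintro ⟨-, h, -⟩
    exact h ((adj_mid_tip (b₁ := b₁) p q).2 hpq)
  have hρ : treeDist (mid p : SpiderSumVertex b₁ b₂) (tip q) = 3 := by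
    rw [treeDist_mid_tip, if_neg hpq]
  rw [isResistance_treeDist.isBraessEdge_iff (realDegree_pos hb₁) (by simp [mid, tip])
    (by simp only [adj_mid_tip, hpq, not_false_eq_true])
    (by rw [hρ]; norm_num) sum_sum_treeDist (sum_sum_treeDist_nonneg hb₁)
    sum_realDegree (sum_treeDist_mid p) (sum_treeDist_tip q) (sum_sq_mid_tip hpq), hρ]
  nlinarith [mul_nonneg (sub_nonneg.2 h1) (sub_nonneg.2 h2),
    sq_nonneg ((b₁ : ℝ) - 1), sq_nonneg ((b₂ : ℝ) - 1)]

theorem not_isBraessEdge_tip_tip (hb₁ : 1 ≤ b₁) (hb₂ : 1 ≤ b₂) {p q : Fin b₂} (hpq : p ≠ q) :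
    ¬ (spiderSum b₁ b₂).IsBraessEdge s(tip p, tip q) := by
  have h1 : (1 : ℝ) ≤ b₁ := by exact_mod_cast hb₁
  have h2 : (1 : ℝ) ≤ b₂ := by exact_mod_cast hb₂
  have hρ : treeDist (tip p : SpiderSumVertex b₁ b₂) (tip q) = 4 := by
    rw [treeDist_tip_tip, if_neg hpq]
  rw [isResistance_treeDist.isBraessEdge_iff (realDegree_pos hb₁) (by simpa [tip] using hpq)
    (by simp only [adj_tip_tip, not_false_eq_true])
    (by rw [hρ]; norm_num) sum_sum_treeDist (sum_sum_treeDist_nonneg hb₁)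
    sum_realDegree (sum_treeDist_tip p) (sum_treeDist_tip q) (sum_sq_tip_tip hpq), hρ]
  -- The quadratic terms cancel: left minus right is 760b₁ + 1200b₂.
  nlinarith [mul_nonneg (sub_nonneg.2 h1) (sub_nonneg.2 h2),
    sq_nonneg ((b₁ : ℝ) - 1), sq_nonneg ((b₂ : ℝ) - 1)]

theorem not_isBraessEdge_center_tip (hb₁ : 1 ≤ b₁) (hb₂ : 1 ≤ b₂) (q : Fin b₂) :
    ¬ (spiderSum b₁ b₂).IsBraessEdge s(center, tip q) := by
  have h1 : (1 : ℝ) ≤ b₁ := by exact_mod_cast hb₁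
  have h2 : (1 : ℝ) ≤ b₂ := by exact_mod_cast hb₂
  rw [isResistance_treeDist.isBraessEdge_iff (realDegree_pos hb₁) (by simp [center, tip])
    (by simp only [adj_center_tip, not_false_eq_true])
    (by rw [treeDist_center_tip]; norm_num) sum_sum_treeDist (sum_sum_treeDist_nonneg hb₁)
    sum_realDegree sum_treeDist_center (sum_treeDist_tip q) (sum_sq_center_tip q),
    treeDist_center_tip]
  -- Left minus right is 16D² + 8D − 24b₁ − 240b₂ with D = 2b₁ + 4b₂.
  nlinarith [mul_nonneg (sub_nonneg.2 h1) (sub_nonneg.2 h2),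
    sq_nonneg ((b₁ : ℝ) - 1), sq_nonneg ((b₂ : ℝ) - 1)]

theorem setOf_isBraessEdge (hb₁ : 1 ≤ b₁) (hb₂ : 1 ≤ b₂) :
    {e | (spiderSum b₁ b₂).IsBraessEdge e} = Sym2.map leaf '' {e : Sym2 (Fin b₁) | ¬ e.IsDiag} := by
  ext e
  constructor
  · induction e with | _ u v
    intro h
    rw [Set.mem_ofPred_eq] at h
    have huv : u ≠ v := by simpa using h.1
    have hadj : ¬ (spiderSum b₁ b₂).Adj u v := by simpa only [mem_edgeSet] using h.2.1
    -- The swapped pair lets each mixed-type lemma cover both orders of its endpoints.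
    have h' : (spiderSum b₁ b₂).IsBraessEdge s(v, u) := by rwa [Sym2.eq_swap]
    rcases exists_eq u with ⟨p, rfl⟩ | rfl | ⟨p, rfl⟩ | ⟨p, rfl⟩ <;>
      rcases exists_eq v with ⟨q, rfl⟩ | rfl | ⟨q, rfl⟩ | ⟨q, rfl⟩
    · exact ⟨s(p, q), by simpa using fun hpq => huv (congrArg leaf hpq), by simp⟩
    · exact absurd ((adj_leaf_center p).2 trivial) hadj
    · exact absurd h (not_isBraessEdge_leaf_mid hb₁ hb₂ p q)
    · exact absurd h (not_isBraessEdge_leaf_tip hb₁ hb₂ p q)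
    · exact absurd ((adj_center_leaf q).2 trivial) hadj
    · exact absurd rfl huv
    · exact absurd ((adj_center_mid q).2 trivial) hadj
    · exact absurd h (not_isBraessEdge_center_tip hb₁ hb₂ q)
    · exact absurd h' (not_isBraessEdge_leaf_mid hb₁ hb₂ q p)
    · exact absurd ((adj_mid_center p).2 trivial) hadj
    · exact absurd h (not_isBraessEdge_mid_mid hb₁ hb₂ fun hpq => huv (congrArg mid hpq))
    · exact absurd h (not_isBraessEdge_mid_tip hb₁ hb₂ p q)
    · exact absurd h' (not_isBraessEdge_leaf_tip hb₁ hb₂ q p)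
    · exact absurd h' (not_isBraessEdge_center_tip hb₁ hb₂ p)
    · exact absurd h' (not_isBraessEdge_mid_tip hb₁ hb₂ q p)
    · exact absurd h (not_isBraessEdge_tip_tip hb₁ hb₂ fun hpq => huv (congrArg tip hpq))
  · rintro ⟨e, he, rfl⟩
    induction e with | _ p q
    rw [Set.mem_ofPred_eq, Sym2.map_mk]
    exact isBraessEdge_leaf_leaf hb₂ (by simpa using he)

end Braess

end SpiderSumVertex

end SpiderSum

end SimpleGraph

end

theorem theorem4p8 (b₁ b₂ : ℕ) (hb₁ : 1 ≤ b₁) (hb₂ : 1 ≤ b₂) :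
    (SimpleGraph.oneSum (SimpleGraph.spider 1 b₁) (SimpleGraph.spider 2 b₂)
      (SimpleGraph.spiderCenter 1 b₁) (SimpleGraph.spiderCenter 2 b₂)).numBraessEdges
      = Nat.choose b₁ 2 := by
  classical
  unfold SimpleGraph.numBraessEdges
  rw [SimpleGraph.SpiderSumVertex.setOf_isBraessEdge hb₁ hb₂,
    Set.ncard_image_of_injective _
      (Sym2.map.injective SimpleGraph.SpiderSumVertex.leaf_injective),
    ← Nat.card_coe_set_eq, Set.coe_ofPred, Nat.card_eq_fintype_card, Sym2.card_subtype_not_diag,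
    Fintype.card_fin]
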